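/- Let $p \ge 2$ be an integer (for instance a prime), and let $M$ be a commutative monoid in the $\infty$-category of spaces (an $\mathbb E_\infty$-monoid, not assumed grouplike). Write $\langle n\rangle$ for the pointed set $\{*,1,\dots,n\}$. Concretely, $M$ is given by a functor $X$ from the category of the finite pointed sets $\langle n\rangle$ and pointed maps to spaces such that for every $n \ge 0$ the Segal map $X\langle n\rangle \to X\langle 1\rangle^n$, induced by the maps $\rho^i\colon \langle n\rangle \to \langle 1\rangle$ with $\rho^i(i)=1$ and $\rho^i(j)=*$ for $j\ne i$, is a weak equivalence; its underlying space is $M = X\langle 1\rangle$. The Frobenius $p\colon M \to M$ is the morphism in the homotopy category of spaces $$M \xrightarrow{\ \Delta\ } M^p \xleftarrow{\ \simeq\ } X\langle p\rangle \xrightarrow{\ +\ } M,$$ where $\Delta$ is the diagonal and $+$ is induced by the map $\langle p\rangle \to \langle 1\rangle$ sending $1,\dots,p$ to $1$. Suppose that $M$ is $p$-perfect, i.e. that $p\colon M \to M$ is an equivalence. Then for every point $m \in M$: 1. $\pi_1(M,m)$ is abelian, and its standard action on $\pi_n(M,m)$ is trivial for all $n \ge 1$ (that is, $M$ is a simple space);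 2. $\pi_n(M,m)$ is uniquely $p$-divisible for all $n \ge 1$, i.e. the map $a \mapsto a^p$ (written $a \mapsto pa$ in additive notation) is a bijection of $\pi_n(M,m)$ onto itself. -/

import Mathlib

open CategoryTheory
open scoped unitInterval Topology Topology.Homotopy

universe u

noncomputable section

/-! ### Induced maps on homotopy groups, and weak homotopy equivalences -/

section Induced

variable {X Y : Type*} [TopologicalSpace X] [TopologicalSpace Y]

/-- The map on path components induced by a continuous map. -/
def zerothHomotopyMap (f : C(X, Y)) : ZerothHomotopy X → ZerothHomotopy Y :=
  ZerothHomotopy.lift (fun x => ZerothHomotopy.mk (f x))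
    (fun _ _ γ => ZerothHomotopy.sound (γ.map f.continuous))

/-- Composition of a generalized loop at `x` with a continuous map. -/
def genLoopMap (N : Type*) (f : C(X, Y)) (x : X) (a : Ω^ N X x) : Ω^ N Y (f x) :=
  ⟨f.comp a.1, fun y hy => congrArg f (a.2 y hy)⟩

/-- The map `π_N(X, x) → π_N(Y, f x)` induced by a continuous map. -/
def homotopyGroupMap (N : Type*) (f : C(X, Y)) (x : X) :
    HomotopyGroup N X x → HomotopyGroup N Y (f x) :=
  Quotient.map (genLoopMap N f x) (fun _ _ h => ContinuousMap.HomotopicRel.comp_continuousMap h f)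

/-- A weak homotopy equivalence: a bijection on path components and on all homotopy groups
`π_k`, `k ≥ 1`, at all base points. -/
def IsWeakHomotopyEquiv (f : C(X, Y)) : Prop :=
  Function.Bijective (zerothHomotopyMap f) ∧
    ∀ (k : ℕ) (x : X), Function.Bijective (homotopyGroupMap (Fin (k + 1)) f x)

end Induced

/-! ### The action of paths on homotopy groups, and simple spaces -/

section Action

variable {N X : Type*} [Fintype N]

/-- Distance of a point of the cube `I^N` from its centre, in the sup norm;
it is `1 / 2` exactly on the boundary. -/
def cubeRadius (t : I^N) : ℝ := ‖fun i => (t i : ℝ) - 1 / 2‖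

/-- Blow up the concentric subcube `[1/4, 3/4]^N` to the whole cube (the rest is pushed to
the boundary). -/
def cubeExpand (t : I^N) : I^N :=
  fun i => Set.projIcc (0 : ℝ) 1 zero_le_one (2 * (t i : ℝ) - 1 / 2)

/-- `B` on the concentric subcube `[1/4, 3/4]^N` (rescaled), and `Γ` on each segment from the
boundary of the subcube (where `Γ` is at time `0`) to the outer boundary
(where `Γ` is at time `1`). -/
def shellMap (Γ : I → X) (B : (I^N) → X) (t : I^N) : X :=
  if cubeRadius t ≤ 1 / 4 then B (cubeExpand t)
  else Γ (Set.projIcc (0 : ℝ) 1 zero_le_one (4 * cubeRadius t - 1))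

theorem cubeRadius_of_mem_boundary {t : I^N} (ht : t ∈ Cube.boundary N) :
    cubeRadius t = 1 / 2 := by
  obtain ⟨i, hi⟩ := ht
  apply le_antisymm
  · refine (pi_norm_le_iff_of_nonneg (by norm_num)).2 fun j => ?_
    rw [Real.norm_eq_abs, abs_le]
    constructor <;> linarith [(t j).2.1, (t j).2.2]
  · refine le_trans ?_ (norm_le_pi_norm (fun i => (t i : ℝ) - 1 / 2) i)
    rcases hi with hi | hi <;> norm_num [hi]

theorem cubeExpand_mem_boundary {t : I^N} (ht : cubeRadius t = 1 / 4) :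
    cubeExpand t ∈ Cube.boundary N := by
  by_contra hcon
  have hlt : cubeRadius t < 1 / 4 := by
    refine (pi_norm_lt_iff (by norm_num)).2 fun i => ?_
    by_contra hi
    rw [Real.norm_eq_abs, not_lt, le_abs] at hi
    refine hcon ⟨i, ?_⟩
    rcases hi with hi | hi
    · exact Or.inr (Set.projIcc_of_right_le _ (by linarith))
    · exact Or.inl (Set.projIcc_of_le_left _ (by linarith))
  exact absurd ht hlt.ne

theorem shellMap_of_mem_boundary (Γ : I → X) (B : (I^N) → X) {t : I^N}
    (ht : t ∈ Cube.boundary N) : shellMap Γ B t = Γ 1 := by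
  rw [shellMap, cubeRadius_of_mem_boundary ht, if_neg (by norm_num),
    Set.projIcc_of_right_le (zero_le_one' ℝ) (by norm_num : (1 : ℝ) ≤ 4 * (1 / 2) - 1)]
  rfl

variable [TopologicalSpace X] {x y : X}

theorem continuous_shellMap {Z : Type*} [TopologicalSpace Z] (Γ : Z × I → X) (B : Z × (I^N) → X)
    (hΓ : Continuous Γ) (hB : Continuous B)
    (h : ∀ z, ∀ s ∈ Cube.boundary N, B (z, s) = Γ (z, 0)) :
    Continuous fun q : Z × (I^N) =>
      shellMap (fun s => Γ (q.1, s)) (fun s => B (q.1, s)) q.2 := by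
  have hr : Continuous (cubeRadius : (I^N) → ℝ) := by unfold cubeRadius; fun_prop
  have he : Continuous (cubeExpand : (I^N) → (I^N)) := by
    unfold cubeExpand
    exact continuous_pi fun i => continuous_projIcc.comp (by fun_prop)
  unfold shellMap
  refine Continuous.if_le (hB.comp (continuous_fst.prodMk (he.comp continuous_snd)))
    (hΓ.comp (continuous_fst.prodMk (continuous_projIcc.comp
      ((continuous_const.mul (hr.comp continuous_snd)).sub continuous_const))))
    (hr.comp continuous_snd) continuous_const ?_
  rintro ⟨z, t⟩ ht
  simp only at ht ⊢
  rw [h z _ (cubeExpand_mem_boundary ht), ht,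
    Set.projIcc_of_le_left (zero_le_one' ℝ) (by norm_num : 4 * (1 / 4) - 1 ≤ (0 : ℝ))]
  rfl

/-- Transport of a generalized loop at `x` to one at `y` along a path from `x` to `y`. -/
def genLoopTransport (γ : Path x y) (β : Ω^ N X x) : Ω^ N X y :=
  ⟨⟨shellMap γ β, (continuous_shellMap (Z := Unit) (fun q => γ q.2) (fun q => β q.2)
      (by fun_prop) (β.1.continuous.comp continuous_snd)
      (fun _ s hs => (β.2 s hs).trans γ.source.symm)).comp
      (continuous_const.prodMk continuous_id : Continuous fun t : I^N => ((), t))⟩,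
    fun _ ht => (shellMap_of_mem_boundary _ _ ht).trans γ.target⟩

theorem genLoopTransport_homotopic {γ γ' : Path x y} (hγ : γ.Homotopic γ') {β β' : Ω^ N X x}
    (hβ : GenLoop.Homotopic β β') :
    GenLoop.Homotopic (genLoopTransport γ β) (genLoopTransport γ' β') := by
  obtain ⟨G⟩ := hγ
  obtain ⟨H⟩ := hβ
  refine ⟨⟨⟨⟨fun q => shellMap (fun s => G (q.1, s)) (fun s => H (q.1, s)) q.2,
    continuous_shellMap G H G.continuous H.continuous ?_⟩, ?_, ?_⟩, ?_⟩⟩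
  · intro z s hs
    rw [H.eq_fst z hs, Path.Homotopy.source]
    exact β.2 s hs
  · intro t
    simp [genLoopTransport]
  · intro t
    simp [genLoopTransport]
  · intro z t ht
    simp only [genLoopTransport, ContinuousMap.coe_mk]
    rw [shellMap_of_mem_boundary _ _ ht, shellMap_of_mem_boundary _ _ ht,
      Path.Homotopy.target, γ.target]

/-- The map `π_N(X, x) → π_N(X, y)` given by a homotopy class of paths from `x` to `y`. -/
def homotopyGroupTransport (γ : Path.Homotopic.Quotient x y) :
    HomotopyGroup N X x → HomotopyGroup N X y :=
  Quotient.map₂ genLoopTransport (fun _ _ hγ _ _ hβ => genLoopTransport_homotopic hγ hβ) γ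

/-- The standard action of `π_1(X, x)` on `π_N(X, x)`. -/
def piOneAct (g : FundamentalGroup X x) (a : HomotopyGroup N X x) : HomotopyGroup N X x :=
  homotopyGroupTransport (FundamentalGroup.toPath g) a

/-- A (not necessarily connected) space is simple if, at every base point, `π_1` is abelian and
acts trivially on `π_n` for all `n ≥ 1`. -/
def IsSimpleSpace (X : Type*) [TopologicalSpace X] : Prop :=
  ∀ x : X, (∀ g h : FundamentalGroup X x, g * h = h * g) ∧
    ∀ (n : ℕ) (g : FundamentalGroup X x) (a : π_ (n + 1) X x), piOneAct g a = a

end Action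

/-! ### Commutative monoids in spaces -/

/-- Objects of the category of finite pointed sets: `⟨n⟩ = {*, 1, …, n}`,
modelled by `Option (Fin n)` with `none` as base point. -/
structure FinPtd : Type where
  /-- The number of elements apart from the base point. -/
  card : ℕ

namespace FinPtd

/-- Pointed maps. -/
@[ext]
structure Hom (A B : FinPtd) : Type where
  /-- The underlying map. -/
  toFun : Option (Fin A.card) → Option (Fin B.card)
  map_none : toFun none = none

instance : Category FinPtd where
  Hom := Hom
  id _ := ⟨fun s => s, rfl⟩
  comp f g := ⟨fun s => g.toFun (f.toFun s), by rw [f.map_none, g.map_none]⟩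

/-- The inert map `⟨n⟩ → ⟨1⟩` which sends `i` to `1` and everything else to the base point. -/
def proj {n : ℕ} (i : Fin n) : FinPtd.mk n ⟶ FinPtd.mk 1 :=
  Hom.mk (fun s => s.bind fun j => if j = i then some 0 else none) rfl

/-- The active map `⟨n⟩ → ⟨1⟩` which sends all of `1, …, n` to `1`. -/
def fold (n : ℕ) : FinPtd.mk n ⟶ FinPtd.mk 1 :=
  Hom.mk (fun s => s.map fun _ => 0) rfl

end FinPtd

/-- The Segal map `X⟨n⟩ → X⟨1⟩ⁿ` of a functor from finite pointed sets to spaces. -/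
def segalMap (F : FinPtd ⥤ TopCat.{u}) (n : ℕ) :
    C(F.obj ⟨n⟩, Fin n → F.obj ⟨1⟩) :=
  ContinuousMap.pi fun i => (F.map (FinPtd.proj i)).hom

/-- A commutative monoid in spaces (an `E_∞`-monoid, not necessarily grouplike): a functor from
finite pointed sets to spaces all of whose Segal maps `X⟨n⟩ → X⟨1⟩ⁿ`, `n ≥ 0`, are weak
equivalences. -/
structure CommMonoidInSpaces where
  /-- The functor from finite pointed sets to spaces. -/
  functor : FinPtd ⥤ TopCat.{u}
  segal (n : ℕ) : IsWeakHomotopyEquiv (segalMap functor n)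

namespace CommMonoidInSpaces

variable (M : CommMonoidInSpaces.{u})

/-- The underlying space `M = X⟨1⟩`. -/
abbrev space : TopCat.{u} := M.functor.obj ⟨1⟩

/-- The diagonal `M → M^p`. -/
def diagonal (p : ℕ) : C(M.space, Fin p → M.space) :=
  ContinuousMap.pi fun _ => ContinuousMap.id M.space

/-- The `p`-fold addition on `X⟨p⟩ ≃ M^p`. -/
def addition (p : ℕ) : C(M.functor.obj ⟨p⟩, M.space) :=
  (M.functor.map (FinPtd.fold p)).hom

/-- In the homotopy category of spaces, the Frobenius `p : M → M` is the composite of the diagonal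
`M → M^p`, the inverse of the Segal equivalence `X⟨p⟩ → M^p`, and the addition `X⟨p⟩ → M`.
This structure is a presentation of it by actual maps: a lift `f` of the diagonal along the Segal
map, up to homotopy, defined on a space `W` which is weakly equivalent to `M` by `w`.
If `M` has the homotopy type of a CW complex one can take `W = M`; in general a CW approximation of
`M`, or the homotopy pullback of the diagonal and the Segal map. -/
structure FrobeniusPresentation (p : ℕ) where
  /-- The source. -/
  W : TopCat.{u}
  /-- The weak equivalence to `M`. -/
  w : C(W, M.space)
  isWeakHomotopyEquiv_w : IsWeakHomotopyEquiv w
  /-- The lift of the diagonal. -/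
  f : C(W, M.functor.obj ⟨p⟩)
  homotopic : ((segalMap M.functor p).comp f).Homotopic ((M.diagonal p).comp w)

/-- The map `W → M` which presents the Frobenius `p : M → M`, i.e. it is the Frobenius composed
with the weak equivalence `w : W → M`, in the homotopy category of spaces. -/
def FrobeniusPresentation.map {M : CommMonoidInSpaces.{u}} {p : ℕ}
    (F : M.FrobeniusPresentation p) : C(F.W, M.space) :=
  (M.addition p).comp F.f

/-- `M` is `p`-perfect if the Frobenius `p : M → M` is an equivalence. (All presentations of the
Frobenius are related by weak equivalences, so it does not matter which one is used.) -/
def IsPPerfect (p : ℕ) : Prop :=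
  ∃ F : M.FrobeniusPresentation p, IsWeakHomotopyEquiv F.map

end CommMonoidInSpaces

end

/-! ### Transport of homotopy classes along paths, and its naturality. -/

section Transport

variable {N X Y : Type*} [TopologicalSpace X] [TopologicalSpace Y] {x y z : X}

/-! Fix `v` in `W` and let `u` in `X⟨p⟩` be its image under the lifted diagonal. By the Segal
equivalence, homotopy groups at `u` are products of `p` homotopy groups of `M`. Addition becomes a
homomorphism `Φ` out of the product, the lift has components `D i`, and perfectness makes `a ↦ Φ (D
i a)_i` bijective. A transposition preserves addition but moves `u`; a suitable path from `u` to its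
image becomes in `M` a loop `ε` carrying the `i`-th summand `Φ (Pi.mulSingle i (D i a))` to the
`j`-th (`exists_loop_swap`).

On `π_1` this is a conjugation. Since `ε` is itself a value of the diagonal, all summands range over
the same subset; as distinct factors commute and there are at least two, `π_1` is abelian
(`MonoidHom.commute_of_conj`). Hence conjugation is trivial, the summands agree, and any single
factor already covers `π_1`.

A loop from factor `i` acts trivially on classes from factor `k ≠ i`. Every loop comes from any
chosen factor, so `π_1` acts trivially on `π_n` (`transportHom_eq_self`). Now `ε` acts trivially
too, so the summands agree on `π_n`, and the bijection `a ↦ Φ (D i a)_i` is the `p`-th power of one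
summand; unique divisibility follows. Every point of `M` is joined by a path to a base point of this
kind. -/

/-- Two generalized loops are freely homotopic along a path `γ` if there is a homotopy between
them which follows `γ` on the boundary of the cube. -/
def FreelyHomotopicAlong {N X : Type*} [TopologicalSpace X] {x y : X} (γ : Path x y)
    (a : Ω^ N X x) (b : Ω^ N X y) : Prop :=
  ∃ K : a.1.Homotopy b.1, ∀ s, ∀ t ∈ Cube.boundary N, K (s, t) = γ s

theorem genLoopTransport_refl [Fintype N] (b : Ω^ N X x) :
    GenLoop.Homotopic (genLoopTransport (Path.refl x) b) b := by
  have hb : ∀ t, genLoopTransport (Path.refl x) b t = b (cubeExpand t) := by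
    intro t
    change shellMap _ _ t = _
    unfold shellMap
    split_ifs with h
    · rfl
    · have : cubeExpand t ∈ Cube.boundary N := by
        by_contra hcon
        refine h ((pi_norm_le_iff_of_nonneg (by norm_num)).2 fun i => ?_)
        by_contra hi
        rw [Real.norm_eq_abs, not_le, lt_abs] at hi
        refine hcon ⟨i, ?_⟩
        rcases hi with hi | hi
        · exact Or.inr (Set.projIcc_of_right_le _ (by linarith))
        · exact Or.inl (Set.projIcc_of_le_left _ (by linarith))
      exact (b.2 _ this).symm
  -- The affine maps from `2t - 1/2` to `t` all send `0` to a value `≤ 0` and `1` to a value `≥ 1`,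
  -- so clamping keeps the boundary on the boundary.
  refine ⟨⟨⟨⟨fun q => b fun i => Set.projIcc (0 : ℝ) 1 zero_le_one
    ((2 - q.1) * (q.2 i : ℝ) - (1 - q.1) / 2), ?_⟩, ?_, ?_⟩, ?_⟩⟩
  · exact b.1.continuous.comp (continuous_pi fun i => continuous_projIcc.comp (by fun_prop))
  · intro t
    refine Eq.trans ?_ (hb t).symm
    change b _ = b _
    congr 1
    funext i
    simp [cubeExpand]
  · intro t
    change b _ = b t
    congr 1
    funext i
    have : ((2 - ((1 : I) : ℝ)) * (t i : ℝ) - (1 - ((1 : I) : ℝ)) / 2) = t i := by simp; ring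
    rw [this, Set.projIcc_val]
  · intro s t ht
    refine Eq.trans ?_ (GenLoop.boundary _ t ht).symm
    refine b.2 _ ?_
    obtain ⟨i, hi⟩ := ht
    refine ⟨i, hi.imp (fun h => ?_) fun h => ?_⟩
    · refine Set.projIcc_of_le_left _ ?_
      dsimp only
      rw [h]
      simp only [Set.Icc.coe_zero]
      linarith [s.2.2]
    · refine Set.projIcc_of_right_le _ ?_
      dsimp only
      rw [h]
      simp only [Set.Icc.coe_one]
      linarith [s.2.2]

namespace FreelyHomotopicAlong

variable {γ : Path x y} {a a' : Ω^ N X x} {b b' : Ω^ N X y}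

/-- A free homotopy determines the transported class: at time `s` fill the inner cube with the
homotopy and let the shell run along the rest of `γ`, from `γ s` to `y`. -/
theorem transport_homotopic [Fintype N] (h : FreelyHomotopicAlong γ a b) :
    GenLoop.Homotopic (genLoopTransport γ a) b := by
  obtain ⟨K, hK⟩ := h
  refine GenLoop.Homotopic.trans ?_ (genLoopTransport_refl b)
  refine ⟨⟨⟨⟨fun q => shellMap (fun r => γ (σ (σ q.1 * σ r))) (fun t => K (q.1, t)) q.2,
    continuous_shellMap (fun q : I × I => γ (σ (σ q.1 * σ q.2))) K (by fun_prop) K.continuous ?_⟩,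
    ?_, ?_⟩, ?_⟩⟩
  · intro s t ht
    simp [hK s t ht]
  · intro t
    simp [genLoopTransport]
  · intro t
    simp only [unitInterval.symm_one, zero_mul, unitInterval.symm_zero, γ.target,
      ContinuousMap.Homotopy.apply_one]
    rfl
  · intro s t ht
    simp only [genLoopTransport, ContinuousMap.coe_mk]
    rw [shellMap_of_mem_boundary _ _ ht, shellMap_of_mem_boundary _ _ ht]
    simp

-- The shell follows `γ` only up to time `s`. At `s = 0` it is constant but still present, so the
-- source is the transport along `Path.refl x`, not `a` itself.
theorem transport [Fintype N] (γ : Path x y) (a : Ω^ N X x) :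
    FreelyHomotopicAlong γ (genLoopTransport (Path.refl x) a) (genLoopTransport γ a) := by
  refine ⟨⟨⟨fun q => shellMap (fun r => γ (q.1 * r)) a q.2,
    continuous_shellMap (fun q : I × I => γ (q.1 * q.2)) (fun q : I × (I^N) => a q.2)
      (by fun_prop) (a.1.continuous.comp continuous_snd) ?_⟩, ?_, ?_⟩, ?_⟩
  · intro s t ht
    simpa using a.2 t ht
  · intro t
    simp only [zero_mul, γ.source]
    rfl
  · intro t
    simp only [one_mul]
    rfl
  · intro s t ht
    refine (shellMap_of_mem_boundary (fun r => γ (s * r)) a ht).trans ?_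
    simp

theorem of_homotopic (h : GenLoop.Homotopic a a') :
    FreelyHomotopicAlong (Path.refl x) a a' := by
  obtain ⟨H⟩ := h
  exact ⟨H.toHomotopy, fun s t ht => (H.eq_fst s ht).trans (a.2 t ht)⟩

theorem trans {γ' : Path y z} {c : Ω^ N X z} (h : FreelyHomotopicAlong γ a b)
    (h' : FreelyHomotopicAlong γ' b c) : FreelyHomotopicAlong (γ.trans γ') a c := by
  obtain ⟨K, hK⟩ := h
  obtain ⟨K', hK'⟩ := h'
  refine ⟨K.trans K', fun s t ht => ?_⟩
  rw [ContinuousMap.Homotopy.trans_apply, Path.trans_apply]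
  split_ifs
  · exact hK _ t ht
  · exact hK' _ t ht

theorem transAt [DecidableEq N] (i : N) (h : FreelyHomotopicAlong γ a b)
    (h' : FreelyHomotopicAlong γ a' b') :
    FreelyHomotopicAlong γ (GenLoop.transAt i a a') (GenLoop.transAt i b b') := by
  obtain ⟨K, hK⟩ := h
  obtain ⟨K', hK'⟩ := h'
  refine ⟨⟨⟨fun q => if (q.2 i : ℝ) ≤ 1 / 2
    then K (q.1, Function.update q.2 i (Set.projIcc 0 1 zero_le_one (2 * (q.2 i : ℝ))))
    else K' (q.1, Function.update q.2 i (Set.projIcc 0 1 zero_le_one (2 * (q.2 i : ℝ) - 1))),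
    ?_⟩, ?_, ?_⟩, ?_⟩
  · refine Continuous.if_le ?_ ?_ (by fun_prop) continuous_const ?_
    · exact K.continuous.comp (continuous_fst.prodMk
        (continuous_snd.update i (continuous_projIcc.comp (by fun_prop))))
    · exact K'.continuous.comp (continuous_fst.prodMk
        (continuous_snd.update i (continuous_projIcc.comp (by fun_prop))))
    · rintro ⟨s, t⟩ ht
      simp only at ht ⊢
      rw [hK s _ ⟨i, Or.inr ?_⟩, hK' s _ ⟨i, Or.inl ?_⟩]
      · rw [Function.update_self, ht]
        exact Set.projIcc_of_le_left _ (by norm_num)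
      · rw [Function.update_self, ht]
        exact Set.projIcc_of_right_le _ (by norm_num)
  · intro t
    simp only [ContinuousMap.Homotopy.apply_zero]
    rfl
  · intro t
    simp only [ContinuousMap.Homotopy.apply_one]
    rfl
  · rintro s t ⟨j, hj⟩
    change (if (t i : ℝ) ≤ 1 / 2 then K (s, Function.update t i _)
      else K' (s, Function.update t i _)) = γ s
    rcases eq_or_ne j i with rfl | hji
    · rcases hj with hj | hj
      · rw [if_pos (by simp [hj])]
        refine hK s _ ⟨j, Or.inl ?_⟩
        dsimp only
        rw [Function.update_self, hj]
        exact Set.projIcc_of_le_left _ (by norm_num)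
      · rw [if_neg (by norm_num [hj])]
        refine hK' s _ ⟨j, Or.inr ?_⟩
        dsimp only
        rw [Function.update_self, hj]
        exact Set.projIcc_of_right_le _ (by norm_num)
    · split_ifs
      · exact hK s _ ⟨j, by rwa [Function.update_of_ne hji]⟩
      · exact hK' s _ ⟨j, by rwa [Function.update_of_ne hji]⟩

theorem transport_mk [Fintype N] (h : FreelyHomotopicAlong γ a b) :
    homotopyGroupTransport (.mk γ) (⟦a⟧ : HomotopyGroup N X x) = (⟦b⟧ : HomotopyGroup N X y) :=
  Quotient.sound h.transport_homotopic

theorem exists_rep [Fintype N] (γ : Path x y) (α : HomotopyGroup N X x) :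
    ∃ (a : Ω^ N X x) (b : Ω^ N X y), (⟦a⟧ : HomotopyGroup N X x) = α ∧
      FreelyHomotopicAlong γ a b := by
  induction α using Quotient.inductionOn with | _ a
  exact ⟨_, _, Quotient.sound (genLoopTransport_refl a), transport γ a⟩

end FreelyHomotopicAlong

theorem homotopyGroupTransport_refl [Fintype N] (α : HomotopyGroup N X x) :
    homotopyGroupTransport (.refl x) α = α := by
  induction α using Quotient.inductionOn with | _ a
  exact Quotient.sound (genLoopTransport_refl a)

theorem homotopyGroupTransport_trans [Fintype N] (γ : Path.Homotopic.Quotient x y)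
    (γ' : Path.Homotopic.Quotient y z) (α : HomotopyGroup N X x) :
    homotopyGroupTransport (γ.trans γ') α =
      homotopyGroupTransport γ' (homotopyGroupTransport γ α) := by
  obtain ⟨γ, rfl⟩ := γ.mk_surjective
  obtain ⟨γ', rfl⟩ := γ'.mk_surjective
  obtain ⟨a, b, rfl, hab⟩ := FreelyHomotopicAlong.exists_rep γ α
  obtain ⟨b', c, hb', hc⟩ := FreelyHomotopicAlong.exists_rep γ' (⟦b⟧ : HomotopyGroup N X y)
  have h := (hab.trans (.of_homotopic (Quotient.exact hb'.symm))).trans hc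
  rw [hab.transport_mk, ← hb', hc.transport_mk, ← h.transport_mk]
  simp

theorem homotopyGroupTransport_mul [Fintype N] [DecidableEq N] [Nonempty N]
    (γ : Path.Homotopic.Quotient x y) (α β : HomotopyGroup N X x) :
    homotopyGroupTransport γ (α * β) =
      homotopyGroupTransport γ α * homotopyGroupTransport γ β := by
  obtain ⟨γ, rfl⟩ := γ.mk_surjective
  obtain ⟨a, b, rfl, hab⟩ := FreelyHomotopicAlong.exists_rep γ α
  obtain ⟨a', b', rfl, hab'⟩ := FreelyHomotopicAlong.exists_rep γ β
  let i : N := Classical.arbitrary N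
  rw [hab.transport_mk, hab'.transport_mk]
  -- `HomotopyGroup.mul_spec` concatenates in the reverse order, hence `hab'` before `hab`.
  exact ((congrArg _ (HomotopyGroup.mul_spec (i := i))).trans (hab'.transAt i hab).transport_mk).trans
    (HomotopyGroup.mul_spec (i := i)).symm

theorem homotopyGroupMap_transport [Fintype N] (f : C(X, Y)) (γ : Path.Homotopic.Quotient x y)
    (α : HomotopyGroup N X x) :
    homotopyGroupMap N f y (homotopyGroupTransport γ α) =
      homotopyGroupTransport (γ.map f) (homotopyGroupMap N f x α) := by
  obtain ⟨γ, rfl⟩ := γ.mk_surjective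
  obtain ⟨a, b, rfl, K, hK⟩ := FreelyHomotopicAlong.exists_rep γ α
  rw [FreelyHomotopicAlong.transport_mk ⟨K, hK⟩]
  refine (FreelyHomotopicAlong.transport_mk (γ := γ.map f.continuous) ⟨.comp (.refl f) K, ?_⟩).symm
  exact fun s t ht => congrArg f (hK s t ht)

theorem homotopyGroupTransport_evalAt [Fintype N] {f g : C(X, Y)} (H : f.Homotopy g)
    (α : HomotopyGroup N X x) :
    homotopyGroupTransport (.mk (H.evalAt x)) (homotopyGroupMap N f x α) =
      homotopyGroupMap N g x α := by
  induction α using Quotient.inductionOn with | _ a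
  refine FreelyHomotopicAlong.transport_mk ⟨ContinuousMap.Homotopy.comp H (.refl a.1), ?_⟩
  intro s t ht
  exact congrArg (fun z => H (s, z)) (a.2 t ht)

theorem homotopyGroupMap_mul [DecidableEq N] [Nonempty N] (f : C(X, Y)) (x : X)
    (α β : HomotopyGroup N X x) :
    homotopyGroupMap N f x (α * β) = homotopyGroupMap N f x α * homotopyGroupMap N f x β := by
  induction α using Quotient.inductionOn with | _ a
  induction β using Quotient.inductionOn with | _ b
  let i : N := Classical.arbitrary N
  refine (congrArg _ (HomotopyGroup.mul_spec (i := i))).trans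
    (Eq.trans ?_ (HomotopyGroup.mul_spec (i := i)).symm)
  refine congrArg (Quotient.mk _) (GenLoop.ext _ _ fun t => ?_)
  exact apply_ite f _ _ _

/-- Loops and relative homotopies in a power are families of such, so the homotopy group of a power
is the power of homotopy groups. -/
theorem homotopyGroupMap_pi_bijective {ι : Type*} (ρ : ι → C(X, Y)) (x : X)
    (h : Function.Bijective (homotopyGroupMap N (ContinuousMap.pi ρ) x)) :
    Function.Bijective fun (α : HomotopyGroup N X x) i => homotopyGroupMap N (ρ i) x α := by
  constructor
  · intro α β hαβ
    apply h.1
    induction α using Quotient.inductionOn with | _ a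
    induction β using Quotient.inductionOn with | _ b
    refine Quotient.sound ⟨ContinuousMap.HomotopyRel.pi (f := fun i => (ρ i).comp a.1)
      (g := fun i => (ρ i).comp b.1) fun i => Classical.choice (Quotient.exact (congrFun hαβ i))⟩
  · intro β
    choose b hb using fun i => Quotient.exists_rep (β i)
    obtain ⟨α, hα⟩ := h.2 (⟦⟨ContinuousMap.pi fun i => (b i).1,
      fun t ht => funext fun i => (b i).2 t ht⟩⟧)
    refine ⟨α, funext fun i => ?_⟩
    rw [← hb]
    induction α using Quotient.inductionOn with | _ a
    obtain ⟨H⟩ := Quotient.exact hα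
    exact Quotient.sound ⟨H.compContinuousMap ⟨_, continuous_apply i⟩⟩

end Transport

/-! ### Group theory of a homomorphism out of a finite product. -/

section Groups

variable {ι P E : Type*} {B : ι → Type*} [Fintype ι] [DecidableEq ι] [Group P] [Group E]
  [∀ i, Group (B i)] (Φ : (∀ i, B i) →* E) (D : ∀ i, P →* B i)

theorem MonoidHom.pairwise_commute_map_mulSingle (x : ∀ i, B i) :
    ((Finset.univ : Finset ι) : Set ι).Pairwise
      (Function.onFun Commute fun i => Φ (Pi.mulSingle i (x i))) :=
  fun i _ j _ _ => (Pi.mulSingle_apply_commute x i j).map Φ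

theorem MonoidHom.map_pi_eq_noncommProd (x : ∀ i, B i) :
    Φ x = Finset.univ.noncommProd (fun i => Φ (Pi.mulSingle i (x i)))
      (Φ.pairwise_commute_map_mulSingle x) :=
  (congrArg Φ (Finset.noncommProd_mulSingle x).symm).trans (Finset.map_noncommProd _ _ _ Φ)

theorem MonoidHom.pi_eq_pow_of_forall_eq (i : ι) (a : P)
    (h : ∀ j, Φ (Pi.mulSingle j (D j a)) = Φ (Pi.mulSingle i (D i a))) :
    Φ (fun j => D j a) = Φ (Pi.mulSingle i (D i a)) ^ Fintype.card ι := by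
  rw [Φ.map_pi_eq_noncommProd, Finset.noncommProd_eq_pow_card _ _ _ _ fun j _ => h j]
  rfl

/-- If the diagonal of a commuting family of homomorphisms with conjugate values is onto, then
the target is abelian. -/
theorem MonoidHom.commute_of_conj [Nontrivial ι]
    (hD : Function.Surjective fun a => Φ fun i => D i a)
    (hconj : ∀ i j, ∃ ε : E, ∀ a, Φ (Pi.mulSingle j (D j a)) * ε =
      ε * Φ (Pi.mulSingle i (D i a))) (c d : E) : c * d = d * c := by
  have hne : ∀ {i j}, i ≠ j → ∀ b b', Commute (Φ (Pi.mulSingle i b)) (Φ (Pi.mulSingle j b')) :=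
    fun hij b b' => (Pi.mulSingle_commute hij b b').map Φ
  have hmem : ∀ i j a, ∃ a', Φ (Pi.mulSingle j (D j a)) = Φ (Pi.mulSingle i (D i a')) := by
    intro i j a
    obtain ⟨ε, hε⟩ := hconj i j
    obtain ⟨x, rfl⟩ := hD ε
    -- As `ε = Φ (D x)`, conjugation by it can be done inside the product, where it preserves the
    -- `i`-th factor.
    refine ⟨x * a * x⁻¹, ?_⟩
    rw [eq_mul_inv_of_mul_eq (hε a), ← map_inv, ← map_mul, ← map_mul]
    congr 1
    funext k
    rcases eq_or_ne k i with rfl | hk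
    · simp
    · simp [hk]
  have hall : ∀ i j a b, Commute (Φ (Pi.mulSingle i (D i a))) (Φ (Pi.mulSingle j (D j b))) := by
    intro i j a b
    by_cases hij : i = j
    -- Two elements from the same factor: move one of them to another factor by `hmem`.
    · obtain ⟨k, hk⟩ := exists_ne j
      obtain ⟨a', ha'⟩ := hmem k i a
      rw [ha']
      exact hne hk _ _
    · exact hne hij _ _
  have hcomm : ∀ i a (c : E), Commute (Φ (Pi.mulSingle i (D i a))) c := by
    intro i a c
    obtain ⟨x, rfl⟩ := hD c
    change Commute _ (Φ fun j => D j x)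
    rw [Φ.map_pi_eq_noncommProd fun j => D j x]
    exact Finset.noncommProd_commute _ _ _ _ fun j _ => hall i j a x
  obtain ⟨x, rfl⟩ := hD d
  change Commute c (Φ fun j => D j x)
  rw [Φ.map_pi_eq_noncommProd fun j => D j x]
  exact Finset.noncommProd_commute _ _ _ _ fun j _ => (hcomm j x c).symm

theorem MonoidHom.surjective_of_forall_eq
    (hD : Function.Surjective fun a => Φ fun i => D i a)
    (h : ∀ i j a, Φ (Pi.mulSingle j (D j a)) = Φ (Pi.mulSingle i (D i a))) (i : ι) :
    Function.Surjective fun a => Φ (Pi.mulSingle i (D i a)) := by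
  intro c
  obtain ⟨a, rfl⟩ := hD c
  refine ⟨a ^ Fintype.card ι, ?_⟩
  simp only
  rw [MonoidHom.pi_eq_pow_of_forall_eq Φ D i a fun j => h i j a, ← map_pow, map_pow,
    ← Pi.mulSingle_pow]

theorem MonoidHom.pow_card_bijective_of_forall_eq [Nonempty ι]
    (hD : Function.Bijective fun a => Φ fun i => D i a)
    (h : ∀ i j a, Φ (Pi.mulSingle j (D j a)) = Φ (Pi.mulSingle i (D i a))) :
    Function.Bijective fun c : E => c ^ Fintype.card ι := by
  obtain ⟨i⟩ := ‹Nonempty ι›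
  have key := fun a => MonoidHom.pi_eq_pow_of_forall_eq Φ D i a fun j => h i j a
  constructor
  · intro c d hcd
    obtain ⟨a, rfl⟩ := MonoidHom.surjective_of_forall_eq Φ D hD.2 h i c
    obtain ⟨b, rfl⟩ := MonoidHom.surjective_of_forall_eq Φ D hD.2 h i d
    rw [hD.1 ((key a).trans (hcd.trans (key b).symm))]
  · intro c
    obtain ⟨a, rfl⟩ := hD.2 c
    exact ⟨_, (key a).symm⟩

end Groups

/-! ### Weak equivalences and fundamental groupoids. -/

section FundamentalGroupoidMaps

variable {X Y Z : Type*} [TopologicalSpace X] [TopologicalSpace Y] [TopologicalSpace Z]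

theorem FundamentalGroupoid.map_comp_map (g : C(Y, Z)) (f : C(X, Y)) {x y : X}
    (γ : FundamentalGroupoid.mk x ⟶ FundamentalGroupoid.mk y) :
    (FundamentalGroupoid.map (g.comp f)).map γ =
      (FundamentalGroupoid.map g).map ((FundamentalGroupoid.map f).map γ) := by
  induction γ using Quotient.inductionOn
  rfl

theorem IsWeakHomotopyEquiv.map_end_bijective {f : C(X, Y)} (hf : IsWeakHomotopyEquiv f) (x : X) :
    Function.Bijective fun γ : FundamentalGroupoid.mk x ⟶ FundamentalGroupoid.mk x =>
      (FundamentalGroupoid.map f).map γ := by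
  let eX := homotopyGroupEquivFundamentalGroupOfUnique (X := X) (x := x) (Fin 1)
  let eY := homotopyGroupEquivFundamentalGroupOfUnique (X := Y) (x := f x) (Fin 1)
  have h : (fun γ : FundamentalGroupoid.mk x ⟶ FundamentalGroupoid.mk x =>
      (FundamentalGroupoid.map f).map γ) = eY ∘ homotopyGroupMap (Fin 1) f x ∘ eX.symm := by
    funext γ
    obtain ⟨α, rfl⟩ := eX.surjective γ
    rw [Function.comp_apply, Function.comp_apply, Equiv.symm_apply_apply]
    induction α using Quotient.inductionOn
    rfl
  rw [h]
  exact eY.bijective.comp ((hf.2 0 x).comp eX.symm.bijective)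

/-- Full faithfulness reduces to endomorphisms by composing with a fixed morphism; injectivity on
`π_0` supplies one whenever the images are connected. -/
theorem IsWeakHomotopyEquiv.map_bijective {f : C(X, Y)} (hf : IsWeakHomotopyEquiv f) (x y : X) :
    Function.Bijective fun γ : FundamentalGroupoid.mk x ⟶ FundamentalGroupoid.mk y =>
      (FundamentalGroupoid.map f).map γ := by
  constructor
  · intro γ γ' h
    simp only at h
    have := (hf.map_end_bijective x).1 (a₁ := γ ≫ Groupoid.inv γ') (a₂ := γ' ≫ Groupoid.inv γ')
      (((FundamentalGroupoid.map f).map_comp _ _).trans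
        ((congrArg (· ≫ _) h).trans ((FundamentalGroupoid.map f).map_comp _ _).symm))
    rw [Groupoid.comp_inv] at this
    rw [← Category.id_comp γ', ← this, Category.assoc, Groupoid.inv_comp, Category.comp_id]
  · intro δ
    have hxy : ZerothHomotopy.mk x = ZerothHomotopy.mk y := by
      apply hf.1.1
      obtain ⟨δ, rfl⟩ := Path.Homotopic.Quotient.mk_surjective δ
      exact ZerothHomotopy.sound δ
    obtain ⟨γ⟩ := Quotient.exact hxy
    let γ' : FundamentalGroupoid.mk x ⟶ FundamentalGroupoid.mk y := Path.Homotopic.Quotient.mk γ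
    obtain ⟨g, hg⟩ := (hf.map_end_bijective x).2
      (δ ≫ Groupoid.inv ((FundamentalGroupoid.map f).map γ'))
    refine ⟨g ≫ γ', ?_⟩
    simp only at hg ⊢
    rw [Functor.map_comp, hg, Category.assoc, Groupoid.inv_comp, Category.comp_id]

theorem IsWeakHomotopyEquiv.map_pi_bijective {ι : Type*} {ρ : ι → C(X, Y)}
    (h : IsWeakHomotopyEquiv (ContinuousMap.pi ρ)) (x y : X) :
    Function.Bijective fun (γ : FundamentalGroupoid.mk x ⟶ FundamentalGroupoid.mk y) i =>
      (FundamentalGroupoid.map (ρ i)).map γ := by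
  have hproj : ∀ (i : ι) (γ : FundamentalGroupoid.mk x ⟶ FundamentalGroupoid.mk y),
      (FundamentalGroupoid.map (ρ i)).map γ =
        Path.Homotopic.proj i ((FundamentalGroupoid.map (ContinuousMap.pi ρ)).map γ) :=
    fun i γ => FundamentalGroupoid.map_comp_map ⟨_, continuous_apply i⟩ (ContinuousMap.pi ρ) γ
  constructor
  · intro γ γ' hγ
    apply (h.map_bijective x y).1
    simp only
    rw [← Path.Homotopic.pi_proj ((FundamentalGroupoid.map (ContinuousMap.pi ρ)).map γ),
      ← Path.Homotopic.pi_proj ((FundamentalGroupoid.map (ContinuousMap.pi ρ)).map γ')]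
    congr 1
    funext i
    rw [← hproj, ← hproj]
    exact congrFun hγ i
  · intro δ
    obtain ⟨γ, hγ⟩ := (h.map_bijective x y).2 (Path.Homotopic.pi δ)
    refine ⟨γ, funext fun i => ?_⟩
    simp only at hγ ⊢
    rw [hproj, hγ]
    exact Path.Homotopic.proj_pi i δ

end FundamentalGroupoidMaps

/-! ### Homotopy groups as local systems on the fundamental groupoid. -/

noncomputable section

/-- Pastes three naturality squares, two of them traversed backwards. -/
theorem CategoryTheory.Groupoid.comp_zigzag {C : Type*} [Groupoid C] {A B D E : C} {d : A ⟶ A}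
    {η : A ⟶ B} {w : B ⟶ B} {η' : D ⟶ B} {d' : D ⟶ D} {κ : E ⟶ D} {r : E ⟶ E}
    (h : d ≫ η = η ≫ w) (h' : d' ≫ η' = η' ≫ w) (hκ : r ≫ κ = κ ≫ d') :
    d ≫ (η ≫ Groupoid.inv η' ≫ Groupoid.inv κ) = (η ≫ Groupoid.inv η' ≫ Groupoid.inv κ) ≫ r := by
  have hr : r = κ ≫ d' ≫ Groupoid.inv κ := by
    rw [← Category.assoc, ← hκ, Category.assoc, Groupoid.comp_inv, Category.comp_id]
  have hd : d' = η' ≫ w ≫ Groupoid.inv η' := by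
    rw [← Category.assoc, ← h', Category.assoc, Groupoid.comp_inv, Category.comp_id]
  rw [reassoc_of% h, hr, hd]
  simp

section HomotopyGroupHoms

variable {X Y Z : Type*} [TopologicalSpace X] [TopologicalSpace Y] [TopologicalSpace Z]

/-- The homomorphism of homotopy groups induced by a continuous map. -/
def homotopyGroupHom (n : ℕ) (f : C(X, Y)) (x : X) : π_ (n + 1) X x →* π_ (n + 1) Y (f x) :=
  MonoidHom.mk' (homotopyGroupMap _ f x) (homotopyGroupMap_mul f x)

theorem homotopyGroupHom_comp (n : ℕ) (g : C(Y, Z)) (f : C(X, Y)) (x : X) (α : π_ (n + 1) X x) :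
    homotopyGroupHom n (g.comp f) x α = homotopyGroupHom n g (f x) (homotopyGroupHom n f x α) := by
  induction α using Quotient.inductionOn
  rfl

/-- The homomorphism of homotopy groups given by a morphism of the fundamental groupoid. -/
def transportHom (n : ℕ) {x y : X} (γ : FundamentalGroupoid.mk x ⟶ FundamentalGroupoid.mk y) :
    π_ (n + 1) X x →* π_ (n + 1) X y :=
  MonoidHom.mk' (homotopyGroupTransport γ) (homotopyGroupTransport_mul γ)

variable (n : ℕ) {x y z : X}

theorem transportHom_id (α : π_ (n + 1) X x) :
    transportHom n (𝟙 (FundamentalGroupoid.mk x)) α = α :=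
  homotopyGroupTransport_refl α

theorem transportHom_comp (γ : FundamentalGroupoid.mk x ⟶ FundamentalGroupoid.mk y)
    (γ' : FundamentalGroupoid.mk y ⟶ FundamentalGroupoid.mk z) (α : π_ (n + 1) X x) :
    transportHom n (γ ≫ γ') α = transportHom n γ' (transportHom n γ α) :=
  homotopyGroupTransport_trans γ γ' α

theorem homotopyGroupHom_transportHom (f : C(X, Y))
    (γ : FundamentalGroupoid.mk x ⟶ FundamentalGroupoid.mk y) (α : π_ (n + 1) X x) :
    homotopyGroupHom n f y (transportHom n γ α) =
      transportHom n (x := f x) (y := f y) ((FundamentalGroupoid.map f).map γ)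
        (homotopyGroupHom n f x α) :=
  homotopyGroupMap_transport f γ α

theorem transportHom_bijective (γ : FundamentalGroupoid.mk x ⟶ FundamentalGroupoid.mk y) :
    Function.Bijective (transportHom n γ) := by
  refine Function.bijective_iff_has_inverse.2
    ⟨transportHom n (Groupoid.inv γ), fun α => ?_, fun α => ?_⟩
  · rw [← transportHom_comp, Groupoid.comp_inv, transportHom_id]
  · rw [← transportHom_comp, Groupoid.inv_comp, transportHom_id]

/-- The morphism of the fundamental groupoid traced by a point in the course of a homotopy. -/
def ContinuousMap.Homotopy.trace {f g : C(X, Y)} (H : f.Homotopy g) (x : X) :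
    FundamentalGroupoid.mk (f x) ⟶ FundamentalGroupoid.mk (g x) :=
  Path.Homotopic.Quotient.mk (H.evalAt x)

theorem ContinuousMap.Homotopy.map_comp_trace {f g : C(X, Y)} (H : f.Homotopy g)
    (γ : FundamentalGroupoid.mk x ⟶ FundamentalGroupoid.mk y) :
    (FundamentalGroupoid.map f).map γ ≫ H.trace y =
      H.trace x ≫ (FundamentalGroupoid.map g).map γ := by
  induction γ using Quotient.inductionOn with | _ γ
  exact Quotient.sound (Path.Homotopic.map_trans_evalAt H γ)

theorem transportHom_trace {f g : C(X, Y)} (H : f.Homotopy g) (α : π_ (n + 1) X x) :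
    transportHom n (H.trace x) (homotopyGroupHom n f x α) = homotopyGroupHom n g x α :=
  homotopyGroupTransport_evalAt H α

theorem transportHom_inv_trace {f g : C(X, Y)} (H : f.Homotopy g) (α : π_ (n + 1) X x) :
    transportHom n (Groupoid.inv (H.trace x)) (homotopyGroupHom n g x α) =
      homotopyGroupHom n f x α := by
  rw [← transportHom_trace n H, ← transportHom_comp, Groupoid.comp_inv, transportHom_id]

end HomotopyGroupHoms

/-! ### Consequences of a perfect symmetric addition. -/

/-- A space `X` which is a power of `M` up to weak equivalence, with a symmetric map `fold` to `M`,
and a lift of the diagonal of `M` to `X` whose composite with `fold` is a weak equivalence. -/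
structure PerfectFold (ι W X M : Type*) [DecidableEq ι] [TopologicalSpace W] [TopologicalSpace X]
    [TopologicalSpace M] where
  /-- The projections. -/
  proj : ι → C(X, M)
  isWeakHomotopyEquiv_pi : IsWeakHomotopyEquiv (ContinuousMap.pi proj)
  /-- The addition. -/
  fold : C(X, M)
  /-- The lift of the diagonal. -/
  lift : C(W, X)
  /-- The map whose diagonal is lifted. -/
  base : C(W, M)
  /-- The lift is a lift up to homotopy. -/
  homotopy (i : ι) : ((proj i).comp lift).Homotopy base
  /-- The transpositions. -/
  swap : ι → ι → C(X, X)
  /-- The addition is invariant under transpositions. -/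
  foldSwap (i j : ι) : (fold.comp (swap i j)).Homotopy fold
  /-- The transpositions permute the projections. -/
  projSwap (i j k : ι) : ((proj k).comp (swap i j)).Homotopy (proj (Equiv.swap i j k))
  isWeakHomotopyEquiv_fold_lift : IsWeakHomotopyEquiv (fold.comp lift)

namespace PerfectFold

variable {ι W X M : Type*} [DecidableEq ι] [TopologicalSpace W] [TopologicalSpace X]
  [TopologicalSpace M] (F : PerfectFold ι W X M) (v : W) (n : ℕ)

/-- The homotopy groups of `X` are products of homotopy groups of `M`. -/
def homotopyGroupEquiv (x : X) : π_ (n + 1) X x ≃* ∀ i, π_ (n + 1) M (F.proj i x) :=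
  MulEquiv.ofBijective (MonoidHom.pi fun i => homotopyGroupHom n (F.proj i) x)
    (homotopyGroupMap_pi_bijective F.proj x (F.isWeakHomotopyEquiv_pi.2 n x))

/-- The fundamental groups of `X` are products of fundamental groups of `M`. -/
def fundamentalGroupEquiv (x : X) :
    FundamentalGroup X x ≃* ∀ i, FundamentalGroup M (F.proj i x) :=
  MulEquiv.ofBijective (MonoidHom.pi fun i => FundamentalGroup.map (F.proj i) x)
    (F.isWeakHomotopyEquiv_pi.map_pi_bijective x x)

/-- The addition on homotopy groups. -/
def homotopyGroupFold (x : X) : (∀ i, π_ (n + 1) M (F.proj i x)) →* π_ (n + 1) M (F.fold x) :=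
  (homotopyGroupHom n F.fold x).comp (F.homotopyGroupEquiv n x).symm.toMonoidHom

/-- The addition on fundamental groups. -/
def fundamentalGroupFold (x : X) :
    (∀ i, FundamentalGroup M (F.proj i x)) →* FundamentalGroup M (F.fold x) :=
  (FundamentalGroup.map F.fold x).comp (F.fundamentalGroupEquiv x).symm.toMonoidHom

/-- The components of the lift of the diagonal on homotopy groups. -/
def homotopyGroupDiag (i : ι) : π_ (n + 1) W v →* π_ (n + 1) M (F.proj i (F.lift v)) :=
  (homotopyGroupHom n (F.proj i) (F.lift v)).comp (homotopyGroupHom n F.lift v)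

/-- The components of the lift of the diagonal on fundamental groups. -/
def fundamentalGroupDiag (i : ι) :
    FundamentalGroup W v →* FundamentalGroup M (F.proj i (F.lift v)) :=
  (FundamentalGroup.map (F.proj i) (F.lift v)).comp (FundamentalGroup.map F.lift v)

theorem homotopyGroupFold_diag (a : π_ (n + 1) W v) :
    F.homotopyGroupFold n (F.lift v) (fun i => F.homotopyGroupDiag v n i a) =
      homotopyGroupHom n (F.fold.comp F.lift) v a := by
  rw [homotopyGroupHom_comp]
  exact congrArg (homotopyGroupHom n F.fold (F.lift v))
    ((F.homotopyGroupEquiv n (F.lift v)).symm_apply_apply (homotopyGroupHom n F.lift v a))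

theorem fundamentalGroupFold_diag (a : FundamentalGroup W v) :
    F.fundamentalGroupFold (F.lift v) (fun i => F.fundamentalGroupDiag v i a) =
      (FundamentalGroupoid.map (F.fold.comp F.lift)).map a := by
  rw [FundamentalGroupoid.map_comp_map]
  exact congrArg (FundamentalGroup.map F.fold (F.lift v))
    ((F.fundamentalGroupEquiv (F.lift v)).symm_apply_apply (FundamentalGroup.map F.lift v a))

theorem homotopyGroupFold_diag_bijective :
    Function.Bijective fun a =>
      F.homotopyGroupFold n (F.lift v) (fun i => F.homotopyGroupDiag v n i a) := by
  rw [funext (F.homotopyGroupFold_diag v n)]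
  exact F.isWeakHomotopyEquiv_fold_lift.2 n v

theorem fundamentalGroupFold_diag_bijective :
    Function.Bijective fun a =>
      F.fundamentalGroupFold (F.lift v) (fun i => F.fundamentalGroupDiag v i a) := by
  rw [funext (F.fundamentalGroupFold_diag v)]
  exact F.isWeakHomotopyEquiv_fold_lift.map_end_bijective v

theorem map_proj_fundamentalGroupEquiv_symm (x : X) (g : ∀ i, FundamentalGroup M (F.proj i x))
    (k : ι) :
    (FundamentalGroupoid.map (F.proj k)).map ((F.fundamentalGroupEquiv x).symm g) = g k :=
  congrFun ((F.fundamentalGroupEquiv x).apply_symm_apply g) k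

theorem homotopyGroupHom_proj_equiv_symm (x : X) (a : ∀ i, π_ (n + 1) M (F.proj i x)) (k : ι) :
    homotopyGroupHom n (F.proj k) x ((F.homotopyGroupEquiv n x).symm a) = a k :=
  congrFun ((F.homotopyGroupEquiv n x).apply_symm_apply a) k

/-- The morphism from `lift v` to its image under a transposition, as prescribed by the
homotopies from the projections of `lift v` to `base v`. -/
theorem exists_hom_swap (i j : ι) :
    ∃ δ : FundamentalGroupoid.mk (F.lift v) ⟶ FundamentalGroupoid.mk (F.swap i j (F.lift v)),
      ∀ k, (FundamentalGroupoid.map (F.proj k)).map δ =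
        (F.homotopy k).trace v ≫ Groupoid.inv ((F.homotopy (Equiv.swap i j k)).trace v) ≫
          Groupoid.inv ((F.projSwap i j k).trace (F.lift v)) := by
  obtain ⟨δ, hδ⟩ := (F.isWeakHomotopyEquiv_pi.map_pi_bijective (F.lift v)
    (F.swap i j (F.lift v))).2 fun k =>
      (F.homotopy k).trace v ≫ Groupoid.inv ((F.homotopy (Equiv.swap i j k)).trace v) ≫
          Groupoid.inv ((F.projSwap i j k).trace (F.lift v))
  exact ⟨δ, congrFun hδ⟩

/-- The loop at `fold (lift v)` traced by a transposition. -/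
theorem exists_loop_swap (i j : ι) : ∃ ε : FundamentalGroup M (F.fold (F.lift v)),
    (∀ a, F.fundamentalGroupFold (F.lift v) (Pi.mulSingle j (F.fundamentalGroupDiag v j a)) * ε =
      ε * F.fundamentalGroupFold (F.lift v) (Pi.mulSingle i (F.fundamentalGroupDiag v i a))) ∧
    ∀ n a, transportHom n ε
      (F.homotopyGroupFold n (F.lift v) (Pi.mulSingle i (F.homotopyGroupDiag v n i a))) =
        F.homotopyGroupFold n (F.lift v) (Pi.mulSingle j (F.homotopyGroupDiag v n j a)) := by
  obtain ⟨δ, hδ⟩ := F.exists_hom_swap v i j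
  refine ⟨(FundamentalGroupoid.map F.fold).map δ ≫ (F.foldSwap i j).trace (F.lift v),
    fun a => ?_, fun n a => ?_⟩
  · let b : ι → (FundamentalGroupoid.mk (F.lift v) ⟶ FundamentalGroupoid.mk (F.lift v)) := fun k =>
      (F.fundamentalGroupEquiv (F.lift v)).symm (Pi.mulSingle k (F.fundamentalGroupDiag v k a))
    -- The Segal equivalence is faithful on fundamental groupoids, so this can be checked on each
    -- projection.
    have hb : b i ≫ δ = δ ≫ (FundamentalGroupoid.map (F.swap i j)).map (b j) := by
      apply (F.isWeakHomotopyEquiv_pi.map_pi_bijective _ _).1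
      funext k
      have hbk : ∀ i k, (FundamentalGroupoid.map (F.proj k)).map (b i) =
          Pi.mulSingle (M := fun i => FundamentalGroup M (F.proj i (F.lift v))) i
            (F.fundamentalGroupDiag v i a) k :=
        fun i k => F.map_proj_fundamentalGroupEquiv_symm _ _ k
      have hdiag : ∀ i, F.fundamentalGroupDiag v i a =
          (FundamentalGroupoid.map ((F.proj i).comp F.lift)).map a :=
        fun i => (FundamentalGroupoid.map_comp_map _ _ _).symm
      -- Moved to `base v`, each family is the class of `a` in one coordinate and trivial elsewhere,
      -- so families with different `i` become comparable.
      have hnat : ∀ i k, (Pi.mulSingle (M := fun i => FundamentalGroup M (F.proj i (F.lift v))) i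
          (F.fundamentalGroupDiag v i a) k).toArrow ≫ (F.homotopy k).trace v =
            (F.homotopy k).trace v ≫
              if k = i then (FundamentalGroup.map F.base v a).toArrow else 𝟙 _ := by
        intro i k
        by_cases hki : k = i
        · subst hki
          rw [if_pos rfl, Pi.mulSingle_eq_same, hdiag]
          exact (F.homotopy k).map_comp_trace a
        · rw [if_neg hki, Pi.mulSingle_eq_of_ne hki]
          exact (Category.id_comp _).trans (Category.comp_id _).symm
      refine ((FundamentalGroupoid.map (F.proj k)).map_comp _ _).trans
        (Eq.trans ?_ ((FundamentalGroupoid.map (F.proj k)).map_comp _ _).symm)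
      have hk := (F.projSwap i j k).map_comp_trace (b j)
      rw [FundamentalGroupoid.map_comp_map, hbk] at hk
      rw [hδ, hbk]
      have hkij : (k = i) = (Equiv.swap i j k = j) := by
        rw [← (Equiv.swap i j).injective.eq_iff, Equiv.swap_apply_left]
      refine Groupoid.comp_zigzag (hnat i k) ?_ hk
      simp only [hkij]
      exact hnat j _
    have hfold := (F.foldSwap i j).map_comp_trace (b j)
    rw [FundamentalGroupoid.map_comp_map] at hfold
    have hb' := ((FundamentalGroupoid.map F.fold).map_comp _ _).symm.trans
      ((congrArg (FundamentalGroupoid.map F.fold).map hb).trans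
        ((FundamentalGroupoid.map F.fold).map_comp _ _))
    -- Products in the fundamental group compose in the reverse order, so the left side begins with
    -- the loop `ε`.
    refine Eq.trans (Category.assoc _ _ _) ((congrArg (_ ≫ ·) hfold.symm).trans ?_)
    exact (Category.assoc _ _ _).symm.trans
      ((congrArg (· ≫ _) hb'.symm).trans (Category.assoc _ _ _))
  · let b : ι → π_ (n + 1) X (F.lift v) := fun k =>
      (F.homotopyGroupEquiv n (F.lift v)).symm (Pi.mulSingle k (F.homotopyGroupDiag v n k a))
    have hbk : ∀ i k, homotopyGroupHom n (F.proj k) (F.lift v) (b i) =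
        Pi.mulSingle (M := fun i => π_ (n + 1) M (F.proj i (F.lift v))) i
          (F.homotopyGroupDiag v n i a) k :=
      fun i k => F.homotopyGroupHom_proj_equiv_symm _ _ _ k
    have hdiag : ∀ i, F.homotopyGroupDiag v n i a =
        homotopyGroupHom n ((F.proj i).comp F.lift) v a :=
      fun i => (homotopyGroupHom_comp _ _ _ _ _).symm
    have hb : transportHom n δ (b i) = homotopyGroupHom n (F.swap i j) (F.lift v) (b j) := by
      apply (F.homotopyGroupEquiv n _).injective
      funext k
      change homotopyGroupHom n (F.proj k) _ _ = homotopyGroupHom n (F.proj k) _ _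
      have hk := transportHom_inv_trace n (F.projSwap i j k) (b j)
      rw [homotopyGroupHom_comp, hbk] at hk
      rw [homotopyGroupHom_transportHom, hδ, hbk]
      refine (transportHom_comp n _ _ _).trans ((transportHom_comp n _ _ _).trans
        (Eq.trans (congrArg _ ?_) hk))
      by_cases hki : k = i
      · subst hki
        rw [Equiv.swap_apply_left, Pi.mulSingle_eq_same, Pi.mulSingle_eq_same, hdiag, hdiag,
          ← transportHom_inv_trace n (F.homotopy j)]
        exact congrArg _ (transportHom_trace n (F.homotopy k) a)
      · have hkj : Equiv.swap i j k ≠ j := fun h =>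
          hki ((Equiv.swap i j).injective (h.trans (Equiv.swap_apply_left i j).symm))
        rw [Pi.mulSingle_eq_of_ne hkj, Pi.mulSingle_eq_of_ne hki]
        exact (congrArg _ (map_one _)).trans (map_one _)
    refine (transportHom_comp n _ _ _).trans ?_
    have hfold := transportHom_trace n (F.foldSwap i j) (b j)
    rw [homotopyGroupHom_comp, ← hb, homotopyGroupHom_transportHom] at hfold
    exact hfold

theorem fundamentalGroup_commute [Fintype ι] [Nontrivial ι]
    (g h : FundamentalGroup M (F.fold (F.lift v))) : g * h = h * g :=
  MonoidHom.commute_of_conj _ _ (F.fundamentalGroupFold_diag_bijective v).2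
    (fun i j => (F.exists_loop_swap v i j).imp fun _ h => h.1) g h

/-- Loops in one factor act trivially on the homotopy groups of the other factors. -/
theorem transportHom_fundamentalGroupFold_mulSingle {i k : ι} (hik : i ≠ k) (x : X)
    (g : FundamentalGroup M (F.proj i x)) (a : π_ (n + 1) M (F.proj k x)) :
    transportHom n (F.fundamentalGroupFold x (Pi.mulSingle i g))
      (F.homotopyGroupFold n x (Pi.mulSingle k a)) =
        F.homotopyGroupFold n x (Pi.mulSingle k a) := by
  -- Lift the action to `X`, where it is coordinatewise: in each coordinate either the loop or the
  -- class is trivial.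
  refine (homotopyGroupHom_transportHom n F.fold _ _).symm.trans (congrArg _ ?_)
  apply (F.homotopyGroupEquiv n x).injective
  funext l
  change homotopyGroupHom n (F.proj l) x (transportHom n _ _) = homotopyGroupHom n (F.proj l) x _
  rw [homotopyGroupHom_transportHom]
  erw [homotopyGroupHom_proj_equiv_symm, map_proj_fundamentalGroupEquiv_symm]
  rcases eq_or_ne l k with rfl | hlk
  · rw [Pi.mulSingle_eq_of_ne hik.symm]
    exact transportHom_id n _
  · rw [Pi.mulSingle_eq_of_ne hlk]
    exact map_one _

theorem transportHom_eq_self [Fintype ι] [Nontrivial ι]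
    (g : FundamentalGroup M (F.fold (F.lift v))) (a : π_ (n + 1) M (F.fold (F.lift v))) :
    transportHom n g a = a := by
  have heq : ∀ i j a, F.fundamentalGroupFold (F.lift v)
      (Pi.mulSingle j (F.fundamentalGroupDiag v j a)) =
        F.fundamentalGroupFold (F.lift v) (Pi.mulSingle i (F.fundamentalGroupDiag v i a)) := by
    intro i j a
    obtain ⟨ε, hε, -⟩ := F.exists_loop_swap v i j
    exact mul_right_cancel ((hε a).trans (F.fundamentalGroup_commute v _ _))
  have hext : (transportHom n g).comp (F.homotopyGroupFold n (F.lift v)) =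
      F.homotopyGroupFold n (F.lift v) := by
    refine MonoidHom.pi_ext fun k b => ?_
    -- The acting loop is rewritten as one from a factor `i ≠ k`.
    obtain ⟨i, hi⟩ := exists_ne k
    obtain ⟨g, rfl⟩ := MonoidHom.surjective_of_forall_eq _ _
      (F.fundamentalGroupFold_diag_bijective v).2 heq i g
    exact F.transportHom_fundamentalGroupFold_mulSingle n hi _ _ b
  obtain ⟨b, rfl⟩ := (F.homotopyGroupFold_diag_bijective v n).2 a
  exact DFunLike.congr_fun hext _

theorem pow_bijective [Fintype ι] [Nontrivial ι] :
    Function.Bijective fun a : π_ (n + 1) M (F.fold (F.lift v)) => a ^ Fintype.card ι := by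
  refine MonoidHom.pow_card_bijective_of_forall_eq _ _ (F.homotopyGroupFold_diag_bijective v n) ?_
  intro i j a
  obtain ⟨ε, -, hε⟩ := F.exists_loop_swap v i j
  rw [← hε, F.transportHom_eq_self]

/-- Surjectivity of `fold ∘ lift` on `π_0` lets results at the points `fold (lift v)` be carried to
all of `M`. -/
theorem exists_hom (F : PerfectFold ι W X M) (m : M) : ∃ v : W,
    Nonempty (FundamentalGroupoid.mk (F.fold (F.lift v)) ⟶ FundamentalGroupoid.mk m) := by
  obtain ⟨v, hv⟩ := F.isWeakHomotopyEquiv_fold_lift.1.2 (ZerothHomotopy.mk m)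
  induction v using Quotient.inductionOn with | _ v
  obtain ⟨γ⟩ := Quotient.exact hv
  exact ⟨v, ⟨Path.Homotopic.Quotient.mk γ⟩⟩

theorem isSimpleSpace (F : PerfectFold ι W X M) [Fintype ι] [Nontrivial ι] : IsSimpleSpace M := by
  intro m
  obtain ⟨v, ⟨γ⟩⟩ := F.exists_hom m
  let e := ((Groupoid.isoEquivHom _ _).symm γ).conj
  refine ⟨fun g h => ?_, fun n g a => ?_⟩
  · apply e.symm.injective
    rw [map_mul, map_mul, F.fundamentalGroup_commute]
  · obtain ⟨b, rfl⟩ := (transportHom_bijective n γ).2 a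
    change transportHom n g.toArrow _ = _
    have h := F.transportHom_eq_self v n (γ ≫ g.toArrow ≫ Groupoid.inv γ) b
    rw [transportHom_comp, transportHom_comp] at h
    apply (transportHom_bijective n (Groupoid.inv γ)).1
    rw [h, ← transportHom_comp, Groupoid.comp_inv, transportHom_id]

theorem pow_card_bijective (F : PerfectFold ι W X M) (n : ℕ) [Fintype ι] [Nontrivial ι] (m : M) :
    Function.Bijective fun a : π_ (n + 1) M m => a ^ Fintype.card ι := by
  obtain ⟨v, ⟨γ⟩⟩ := F.exists_hom m
  let e := MulEquiv.ofBijective _ (transportHom_bijective n γ)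
  have h : (fun a : π_ (n + 1) M m => a ^ Fintype.card ι) =
      e ∘ (fun a => a ^ Fintype.card ι) ∘ e.symm := by
    funext a
    simp
  rw [h]
  exact e.bijective.comp ((F.pow_bijective v n).comp e.symm.bijective)

end PerfectFold

/-! ### Permutations of finite pointed sets, and the main theorem. -/

namespace FinPtd

/-- The map induced by a permutation of `1, …, n`. -/
def perm {n : ℕ} (e : Equiv.Perm (Fin n)) : FinPtd.mk n ⟶ FinPtd.mk n :=
  FinPtd.Hom.mk (Option.map e) rfl

theorem perm_comp_fold {n : ℕ} (e : Equiv.Perm (Fin n)) :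
    FinPtd.perm e ≫ FinPtd.fold n = FinPtd.fold n :=
  FinPtd.Hom.ext (funext fun s => by cases s <;> rfl)

theorem perm_comp_proj {n : ℕ} (e : Equiv.Perm (Fin n)) (k : Fin n) :
    FinPtd.perm e ≫ FinPtd.proj k = FinPtd.proj (e.symm k) := by
  refine FinPtd.Hom.ext (funext fun s => ?_)
  cases s with
  | none => rfl
  | some j =>
    change (if e j = k then _ else _) = (if j = e.symm k then _ else _)
    simp only [Equiv.eq_symm_apply]

end FinPtd

namespace CommMonoidInSpaces

/-- A presentation of the Frobenius which is a weak equivalence gives a perfect fold. -/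
def FrobeniusPresentation.perfectFold {M : CommMonoidInSpaces.{u}} {p : ℕ}
    (F : M.FrobeniusPresentation p) (hF : IsWeakHomotopyEquiv F.map) :
    PerfectFold (Fin p) F.W (M.functor.obj ⟨p⟩) M.space where
  proj i := (M.functor.map (FinPtd.proj i)).hom
  isWeakHomotopyEquiv_pi := M.segal p
  fold := M.addition p
  lift := F.f
  base := F.w
  homotopy i := ContinuousMap.Homotopy.comp
    (.refl (⟨_, continuous_apply i⟩ : C(Fin p → M.space, M.space))) F.homotopic.some
  swap i j := (M.functor.map (FinPtd.perm (Equiv.swap i j))).hom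
  -- Functoriality makes both symmetries strict equalities, so constant homotopies suffice.
  foldSwap i j := (ContinuousMap.Homotopy.refl (M.addition p)).cast (by
    rw [addition, ← TopCat.hom_comp, ← Functor.map_comp, FinPtd.perm_comp_fold]) rfl
  projSwap i j k := (ContinuousMap.Homotopy.refl
    (M.functor.map (FinPtd.proj (Equiv.swap i j k))).hom).cast (by
      rw [← TopCat.hom_comp, ← Functor.map_comp, FinPtd.perm_comp_proj, Equiv.symm_swap]) rfl
  isWeakHomotopyEquiv_fold_lift := hF

end CommMonoidInSpaces

end

theorem theorem1p2 (p : ℕ) (hp : 2 ≤ p) (M : CommMonoidInSpaces.{u}) (hM : M.IsPPerfect p) :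
    IsSimpleSpace M.space ∧
      ∀ (m : M.space) (n : ℕ),
        Function.Bijective (fun a : π_ (n + 1) M.space m => a ^ p) := by
  obtain ⟨F, hF⟩ := hM
  -- The only use of `2 ≤ p`: there must be a second factor.
  have : Nontrivial (Fin p) := Fin.nontrivial_iff_two_le.2 hp
  refine ⟨(F.perfectFold hF).isSimpleSpace, fun m n => ?_⟩
  simpa only [Fintype.card_fin] using (F.perfectFold hF).pow_card_bijective n m
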